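/- Let $\mathbb F$ be an arbitrary field, let $m,n\ge 1$ be integers, let $\underline d=(d_1,\dots,d_m)$ be a list of nonnegative integers, and assume $d:=\max_{1\le i\le m} d_i>0$. Let $M(\lambda)=\sum_{j=0}^{d}M_j\lambda^j$ be an $m\times(m+n)$ polynomial matrix over $\mathbb F$ whose $i$th row has degree at most $d_i$ for $i=1,\dots,m$. For $k\ge 1$, the $k$th Sylvester matrix of $M$ is the constant matrix with $k+d$ block rows and $k$ block columns whose block in block row $a$ and block column $b$ is $M_{a-b}$ (zero if $a-b\notin\{0,\dots,d\}$). The $k$th trimmed Sylvester matrix $T_k$ is the $\bigl(km+\sum_i d_i\bigr)\times k(m+n)$ submatrix obtained from it by deleting, for each $i=1,\dots,m$, the $i$th row of each of the last $d-d_i$ block rows (these rows are zero). $M$ has full-trimmed-Sylvester-rank if $\operatorname{rank} T_k=\min\{km+\sum_{i} d_i,\;k(m+n)\}$ for all $k=1,2,\dots$. A minimal basis of a subspace $\mathcal V\subseteq\mathbb F(\lambda)^p$ is a basis of $\mathcal V$ consisting of polynomial vectors whose sum of degrees is minimal among all bases of $\mathcal V$ consisting of polynomial vectors; the degrees of its vectors,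 counted with repetitions, are the minimal indices of $\mathcal V$ (none if $\mathcal V=0$). The right (left) minimal indices of $M$ are those of its right (left) null space over $\mathbb F(\lambda)$. The finite elementary divisors of a polynomial matrix are the prime power factors over $\mathbb F$ of its (nonzero, monic) invariant polynomials, counted with repetitions. The infinite elementary divisors of $M$ are the elementary divisors associated to the eigenvalue $0$ (the powers of $\lambda$) of $\operatorname{rev}_d M(\lambda)=\lambda^d M(1/\lambda)$. The complete eigenstructure of $M$ consists of its finite and infinite elementary divisors and its left and right minimal indices. Let $\alpha_k$ be the number of right minimal indices of $M$ equal to $k$, let $k':=\bigl\lceil \tfrac1n\sum_{i=1}^m d_i\bigr\rceil$, and define $t$ by $nk'=\sum_{i=1}^m d_i+t$, so that $0\le t<n$. Theorem. $M(\lambda)$ has full-trimmed-Sylvester-rank if and only if the complete eigenstructure of $M(\lambda)$ consists of 1. the right minimal indices described by $\alpha_{k'-1}=t$, $\alpha_{k'}=n-t$, and $\alpha_j=0$ for $j\notin\{k'-1,k'\}$, and 2. one infinite elementary divisor $\lambda^{d-d_i}$ (that is, of degree $d-d_i$) for each $i\in\{1,\dots,m\}$ with $d_i<d$; in particular, $M(\lambda)$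 then has no finite elementary divisors and no left minimal indices. -/

import Mathlib

open Polynomial

noncomputable section

namespace PolyMat

variable {F : Type*} [Field F]

/-! ### Minimal bases and minimal indices of rational subspaces -/

/-- The degree of a polynomial vector: the highest degree of its entries. -/
def vecDegree {ι : Type*} [Fintype ι] (v : ι → F[X]) : ℕ :=
  Finset.univ.sup fun i => (v i).natDegree

/-- A polynomial vector seen as a vector with entries in the field `F(λ)`. -/
def toRat {ι : Type*} (v : ι → F[X]) : ι → RatFunc F :=
  fun i => algebraMap F[X] (RatFunc F) (v i)

/-- `b` is a basis of the rational subspace `V` consisting of polynomial vectors. -/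
structure IsPolynomialBasis {ι : Type*} (V : Submodule (RatFunc F) (ι → RatFunc F))
    {r : ℕ} (b : Fin r → ι → F[X]) : Prop where
  linearIndependent : LinearIndependent (RatFunc F) fun j => toRat (b j)
  span_eq : Submodule.span (RatFunc F) (Set.range fun j => toRat (b j)) = V

/-- `b` is a minimal basis of `V`: its sum of degrees is minimal among all bases of `V`
consisting of polynomial vectors. -/
structure IsMinimalBasis {ι : Type*} [Fintype ι] (V : Submodule (RatFunc F) (ι → RatFunc F))
    {r : ℕ} (b : Fin r → ι → F[X]) : Prop extends IsPolynomialBasis V b where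
  sum_le : ∀ c : Fin r → ι → F[X], IsPolynomialBasis V c →
    ∑ j, vecDegree (b j) ≤ ∑ j, vecDegree (c j)

theorem exists_isPolynomialBasis {ι : Type*} [Fintype ι]
    (V : Submodule (RatFunc F) (ι → RatFunc F)) :
    ∃ b : Fin (Module.finrank (RatFunc F) V) → ι → F[X], IsPolynomialBasis V b := by
  classical
  let B := Module.finBasis (RatFunc F) V
  have key : ∀ j, ∃ v : ι → F[X], ∃ a : F[X], a ≠ 0 ∧
      toRat v = algebraMap F[X] (RatFunc F) a • (B j : ι → RatFunc F) := by
    intro j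
    obtain ⟨a, ha⟩ := IsLocalization.exist_integer_multiples_of_finite
      (nonZeroDivisors F[X]) (B j : ι → RatFunc F)
    choose v hv using ha
    refine ⟨v, a, nonZeroDivisors.coe_ne_zero a, ?_⟩
    funext i
    simp [toRat, hv i, Algebra.smul_def]
  choose b a ha hb using key
  have ha' : ∀ j, algebraMap F[X] (RatFunc F) (a j) ≠ 0 := fun j => by
    simpa using ha j
  let w : Fin (Module.finrank (RatFunc F) V) → (RatFunc F)ˣ :=
    fun j => Units.mk0 _ (ha' j)
  have hfun : (fun j => toRat (b j)) = V.subtype ∘ (B.unitsSMul w) := by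
    funext j
    simp only [Function.comp_apply, Module.Basis.unitsSMul_apply, hb j]
    rfl
  refine ⟨b, ?_, ?_⟩
  · rw [hfun]
    exact (B.unitsSMul w).linearIndependent.map' V.subtype (Submodule.ker_subtype V)
  · rw [hfun, Set.range_comp, Submodule.span_image, Module.Basis.span_eq,
      Submodule.map_subtype_top]

/-- Every rational subspace has a minimal basis. -/
theorem exists_isMinimalBasis {ι : Type*} [Fintype ι]
    (V : Submodule (RatFunc F) (ι → RatFunc F)) :
    ∃ b : Fin (Module.finrank (RatFunc F) V) → ι → F[X], IsMinimalBasis V b := by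
  classical
  have h : ∃ s : ℕ, ∃ b : Fin (Module.finrank (RatFunc F) V) → ι → F[X],
      IsPolynomialBasis V b ∧ ∑ j, vecDegree (b j) = s := by
    obtain ⟨b, hb⟩ := exists_isPolynomialBasis V
    exact ⟨_, b, hb, rfl⟩
  obtain ⟨b, hb, hs⟩ := Nat.find_spec h
  refine ⟨b, hb, fun c hc => ?_⟩
  rw [hs]
  exact Nat.find_min' h ⟨c, hc, rfl⟩

/-- The minimal indices of a rational subspace: the degrees of the vectors of a minimal basis,
counted with repetitions (all minimal bases have the same ones). -/
def minimalIndices {ι : Type*} [Fintype ι] (V : Submodule (RatFunc F) (ι → RatFunc F)) :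
    Multiset ℕ :=
  Finset.univ.val.map fun j => vecDegree (Classical.choose (exists_isMinimalBasis V) j)

/-- The polynomial matrix `P` seen as a matrix over the field `F(λ)`. -/
def ratMatrix {m p : ℕ} (P : Matrix (Fin m) (Fin p) F[X]) :
    Matrix (Fin m) (Fin p) (RatFunc F) :=
  P.map (algebraMap F[X] (RatFunc F))

/-- The rank (normal rank) of a polynomial matrix. -/
def normalRank {m p : ℕ} (P : Matrix (Fin m) (Fin p) F[X]) : ℕ :=
  (ratMatrix P).rank

/-- The right minimal indices: those of the right null space `{v | P v = 0}` over `F(λ)`.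
There are none when this space is trivial. -/
def rightMinimalIndices {m p : ℕ} (P : Matrix (Fin m) (Fin p) F[X]) : Multiset ℕ :=
  minimalIndices (LinearMap.ker (ratMatrix P).mulVecLin)

/-- The left minimal indices: those of the left null space `{v | vᵀ P = 0}` over `F(λ)`.
There are none when this space is trivial. -/
def leftMinimalIndices {m p : ℕ} (P : Matrix (Fin m) (Fin p) F[X]) : Multiset ℕ :=
  minimalIndices (LinearMap.ker (ratMatrix P).vecMulLinear)

/-! ### Elementary divisors -/

open Classical in
/-- The `k`th determinantal divisor: the monic greatest common divisor of all minors of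
order `k` (equal to `1` for `k = 0`, and to `0` if `k` exceeds the rank). -/
def determinantalDivisor {m p : ℕ} (P : Matrix (Fin m) (Fin p) F[X]) (k : ℕ) : F[X] :=
  normalize (Submodule.IsPrincipal.generator (Ideal.span
    (Set.range fun rc : (Fin k ↪o Fin m) × (Fin k ↪o Fin p) =>
      (P.submatrix rc.1 rc.2).det)))

/-- The invariant polynomials of `P` are `invariantPolynomial P k` for `k < normalRank P`: the
successive quotients of the determinantal divisors, that is, the diagonal entries of the
Smith form of `P`. -/
def invariantPolynomial {m p : ℕ} (P : Matrix (Fin m) (Fin p) F[X]) (k : ℕ) : F[X] :=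
  determinantalDivisor P (k + 1) / determinantalDivisor P k

open Classical in
/-- The full prime power factors `q ^ e` (with `q` monic irreducible, `e ≥ 1`) of a nonzero
polynomial. -/
def primePowerFactors (f : F[X]) : Multiset F[X] :=
  (UniqueFactorizationMonoid.normalizedFactors f).toFinset.val.map fun q =>
    q ^ (UniqueFactorizationMonoid.normalizedFactors f).count q

/-- The (finite) elementary divisors of `P`: the prime power factors of its invariant
polynomials, counted with repetitions. -/
def elementaryDivisors {m p : ℕ} (P : Matrix (Fin m) (Fin p) F[X]) : Multiset F[X] :=
  ∑ k ∈ Finset.range (normalRank P), primePowerFactors (invariantPolynomial P k)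

/-- The reversal `λ ^ d • P(1/λ)` of a polynomial matrix of degree at most `d`. -/
def rev {m p : ℕ} (d : ℕ) (P : Matrix (Fin m) (Fin p) F[X]) : Matrix (Fin m) (Fin p) F[X] :=
  P.map (Polynomial.reflect d)

open Classical in
/-- The infinite elementary divisors of `P`, as a matrix of degree at most `d`: the elementary
divisors of `rev d P` associated to the eigenvalue zero. -/
def infiniteElementaryDivisors {m p : ℕ} (d : ℕ) (P : Matrix (Fin m) (Fin p) F[X]) :
    Multiset F[X] :=
  (elementaryDivisors (rev d P)).filter fun q => X ∣ q

/-! ### Trimmed Sylvester matrices -/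

/-- The degree of the `i`th row of `M` is at most `d i`, for every `i`. -/
def RowDegreesLE {m p : ℕ} (d : Fin m → ℕ) (M : Matrix (Fin m) (Fin p) F[X]) : Prop :=
  ∀ i j, (M i j).natDegree ≤ d i

/-- The maximum of the list `d`. -/
def maxDegree {m : ℕ} (d : Fin m → ℕ) : ℕ := Finset.univ.sup d

/-- The `k`th Sylvester matrix of a polynomial matrix `M` of degree at most `d`: it has `k + d`
block rows and `k` block columns, and its block `(a, b)` is the coefficient `M_{a - b}`
(zero if `a < b`, and also if `a - b > d`). -/
def sylvester {m p : ℕ} (d k : ℕ) (M : Matrix (Fin m) (Fin p) F[X]) :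
    Matrix (Fin (k + d) × Fin m) (Fin k × Fin p) F :=
  Matrix.of fun r c =>
    if (c.1 : ℕ) ≤ (r.1 : ℕ) then (M r.2 c.2).coeff ((r.1 : ℕ) - (c.1 : ℕ)) else 0

/-- The `k`th trimmed Sylvester matrix: in the rows of the Sylvester matrix coming from the
`i`th row of `M`, only the first `k + d i` are kept. -/
def trimmedSylvester {m p : ℕ} (d : Fin m → ℕ) (k : ℕ) (M : Matrix (Fin m) (Fin p) F[X]) :
    Matrix {r : Fin (k + maxDegree d) × Fin m // (r.1 : ℕ) < k + d r.2} (Fin k × Fin p) F :=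
  (sylvester (maxDegree d) k M).submatrix Subtype.val id

/-- `M` has full-trimmed-Sylvester-rank: every trimmed Sylvester matrix has full rank. -/
def FullTrimmedSylvesterRank {m n : ℕ} (d : Fin m → ℕ)
    (M : Matrix (Fin m) (Fin (m + n)) F[X]) : Prop :=
  ∀ k : ℕ, 1 ≤ k →
    (trimmedSylvester d k M).rank = min (k * m + ∑ i, d i) (k * (m + n))

end PolyMat

end

open Polynomial

noncomputable section

namespace PolyMat

variable {F : Type*} [Field F]

/-! ### Minimal bases generate all polynomial vectors, with predictable degrees -/

section MinimalBasis

variable {ι : Type*}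

/-! Write S = Σ d_i. The kernel of T_k is the space of polynomial vectors of degree < k in the right
null space of M. A minimal basis generates all polynomial vectors of that null space without
cancellation of leading degrees, so the kernel has dimension Σ_e max(k - e, 0), with e running over
the right minimal indices (`finrank_ker_trimmedSylvester`). Hence full rank for all k ≥ 1 means that
this sum equals max(nk - S, 0) for all k ≥ 1. Second differences in k recover the multiplicities of
the indices, and nk' = S + t turns the equality into condition 1 (`sum_map_sub_eq_iff`). Condition 1
alone is therefore equivalent to full rank.

The rest of the eigenstructure follows from one k for which T_k has full row rank: M then maps
vectors of degree < k onto all vectors whose i-th entry has degree < k + d_i (`exists_mulVec_eq`).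
Reaching the unit vectors gives a polynomial right inverse of M, which excludes left minimal indices
and finite elementary divisors. Reaching λ^(d_i + k - 1) e_i gives a right inverse of the matrix of
row leading coefficients. Since rev M = diag(λ^(d - d_i)) R, where R(0) is that matrix, the power of
λ in the determinantal divisor of order j is the sum of the j smallest d - d_i, which determines the
infinite elementary divisors. -/

/-- `toRat` as a linear map over the polynomial ring. -/
def toRatHom (F : Type*) [Field F] (ι : Type*) : (ι → F[X]) →ₗ[F[X]] (ι → RatFunc F) :=
  (Algebra.linearMap F[X] (RatFunc F)).compLeft ι

theorem toRatHom_apply (v : ι → F[X]) : toRatHom F ι v = toRat v := rfl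

theorem toRatHom_injective : Function.Injective (toRatHom F ι) := fun v w h => by
  funext i
  exact RatFunc.algebraMap_injective F (congrFun h i)

theorem toRat_smul (a : F[X]) (v : ι → F[X]) :
    toRat (a • v) = algebraMap F[X] (RatFunc F) a • toRat v := by
  funext i
  simp [toRat]

theorem toRat_sum_smul {r : ℕ} (a : Fin r → F[X]) (b : Fin r → ι → F[X]) :
    toRat (∑ j, a j • b j) = ∑ j, algebraMap F[X] (RatFunc F) (a j) • toRat (b j) := by
  rw [← toRatHom_apply, map_sum]
  exact Finset.sum_congr rfl fun j _ => toRat_smul _ _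

variable {V : Submodule (RatFunc F) (ι → RatFunc F)} {r : ℕ} {b : Fin r → ι → F[X]}

theorem IsPolynomialBasis.linearIndependent_poly (hb : IsPolynomialBasis V b) :
    LinearIndependent F[X] b := by
  have h := hb.linearIndependent.restrict_scalars' F[X]
  exact LinearIndependent.of_comp (toRatHom F ι) h

theorem IsPolynomialBasis.toRat_mem (hb : IsPolynomialBasis V b) (j : Fin r) :
    toRat (b j) ∈ V := by
  rw [← hb.span_eq]
  exact Submodule.subset_span ⟨j, rfl⟩

theorem IsPolynomialBasis.sum_smul_mem (hb : IsPolynomialBasis V b) (a : Fin r → F[X]) :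
    toRat (∑ j, a j • b j) ∈ V := by
  rw [toRat_sum_smul]
  exact V.sum_mem fun j _ => V.smul_mem _ (hb.toRat_mem j)

/-- Every polynomial vector of `V` has a polynomial multiple in the `F[X]`-span of `b`. -/
theorem IsPolynomialBasis.exists_smul_eq (hb : IsPolynomialBasis V b) {v : ι → F[X]}
    (hv : toRat v ∈ V) : ∃ D : F[X], D ≠ 0 ∧ ∃ a : Fin r → F[X], D • v = ∑ j, a j • b j := by
  rw [← hb.span_eq, Submodule.mem_span_range_iff_exists_fun] at hv
  obtain ⟨c, hc⟩ := hv
  obtain ⟨D, hD⟩ := IsLocalization.exist_integer_multiples_of_finite (nonZeroDivisors F[X]) c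
  choose a ha using hD
  refine ⟨D, nonZeroDivisors.coe_ne_zero D, a, toRatHom_injective ?_⟩
  rw [toRatHom_apply, toRatHom_apply, toRat_sum_smul, toRat_smul, ← hc, Finset.smul_sum]
  refine Finset.sum_congr rfl fun j _ => ?_
  rw [ha j, smul_smul, ← Algebra.smul_def]

/-- The exchange property of polynomial bases. -/
theorem IsPolynomialBasis.update (hb : IsPolynomialBasis V b) {w : ι → F[X]} {D : F[X]}
    (hD : D ≠ 0) {s : Fin r → F[X]} (hw : D • w = ∑ j, s j • b j) {j₀ : Fin r}
    (hs : s j₀ ≠ 0) : IsPolynomialBasis V (Function.update b j₀ w) := by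
  classical
  have inj := RatFunc.algebraMap_injective F
  have hD' : algebraMap F[X] (RatFunc F) D ≠ 0 := by simpa using hD
  have hs' : algebraMap F[X] (RatFunc F) (s j₀) ≠ 0 := by simpa using hs
  have hw' : algebraMap F[X] (RatFunc F) D • toRat w =
      ∑ j, algebraMap F[X] (RatFunc F) (s j) • toRat (b j) := by
    rw [← toRat_smul, hw, toRat_sum_smul]
  have hwV : toRat w ∈ V := by
    rw [← V.smul_mem_iff hD', hw']
    exact V.sum_mem fun j _ => V.smul_mem _ (hb.toRat_mem j)
  have hspan : Submodule.span (RatFunc F)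
      (Set.range fun j => toRat (Function.update b j₀ w j)) = V := by
    apply le_antisymm
    · rw [Submodule.span_le]
      rintro _ ⟨j, rfl⟩
      rcases eq_or_ne j j₀ with rfl | h
      · simpa using hwV
      · simpa [h] using hb.toRat_mem j
    · set W := Submodule.span (RatFunc F)
        (Set.range fun j => toRat (Function.update b j₀ w j)) with hW
      have hmem : ∀ j, toRat (Function.update b j₀ w j) ∈ W := fun j =>
        Submodule.subset_span ⟨j, rfl⟩
      have hne : ∀ j, j ≠ j₀ → toRat (b j) ∈ W := fun j h => by simpa [h] using hmem j
      have hwW : toRat w ∈ W := by simpa using hmem j₀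
      have h0 : toRat (b j₀) ∈ W := by
        rw [← W.smul_mem_iff hs']
        have : algebraMap F[X] (RatFunc F) (s j₀) • toRat (b j₀) =
            algebraMap F[X] (RatFunc F) D • toRat w -
              ∑ j ∈ Finset.univ.erase j₀, algebraMap F[X] (RatFunc F) (s j) • toRat (b j) := by
          rw [hw', ← Finset.add_sum_erase _ _ (Finset.mem_univ j₀), add_sub_cancel_right]
        rw [this]
        exact W.sub_mem (W.smul_mem _ hwW) (W.sum_mem fun j hj =>
          W.smul_mem _ (hne j (Finset.ne_of_mem_erase hj)))
      rw [← hb.span_eq, Submodule.span_le]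
      rintro _ ⟨j, rfl⟩
      rcases eq_or_ne j j₀ with rfl | h
      · exact h0
      · exact hne j h
  refine ⟨?_, hspan⟩
  -- As many vectors as the dimension of V, spanning V, are independent.
  rw [linearIndependent_iff_card_eq_finrank_span, Set.finrank, hspan, ← hb.span_eq]
  exact linearIndependent_iff_card_eq_finrank_span.mp hb.linearIndependent

/-- The polynomial vectors of `V` with entries of degree less than `k`. -/
def polyVectorsLT (V : Submodule (RatFunc F) (ι → RatFunc F)) (k : ℕ) :
    Submodule F (ι → F[X]) where
  carrier := {v | toRat v ∈ V ∧ ∀ i, v i ∈ degreeLT F k}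
  add_mem' {v w} hv hw := ⟨by
    rw [← toRatHom_apply, map_add]
    exact V.add_mem hv.1 hw.1, fun i => Submodule.add_mem _ (hv.2 i) (hw.2 i)⟩
  zero_mem' := ⟨by rw [← toRatHom_apply, map_zero]; exact V.zero_mem,
    fun i => Submodule.zero_mem _⟩
  smul_mem' c v hv := ⟨by
    have : c • v = (C c : F[X]) • v := by
      funext i
      simp [smul_eq_C_mul]
    rw [this, toRat_smul]
    exact V.smul_mem _ hv.1, fun i => Submodule.smul_mem _ c (hv.2 i)⟩

theorem mem_polyVectorsLT {k : ℕ} {v : ι → F[X]} :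
    v ∈ polyVectorsLT V k ↔ toRat v ∈ V ∧ ∀ i, (v i).degree < (k : WithBot ℕ) := by
  simp only [← mem_degreeLT]
  rfl

/-- Subtraction is truncated: for k ≤ e both sides say q = 0. The guard is needed because
`natDegree` of 0 is 0. -/
theorem mem_degreeLT_sub {q : F[X]} {k e : ℕ} :
    q ∈ degreeLT F (k - e) ↔ (q ≠ 0 → q.natDegree + e < k) := by
  rw [mem_degreeLT]
  rcases eq_or_ne q 0 with rfl | h
  · simp
  · rw [degree_eq_natDegree h, Nat.cast_lt]
    simp only [ne_eq, h, not_false_eq_true, forall_const]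
    omega

theorem natDegree_lt_of_degree_lt {p : F[X]} {N : ℕ} (hN : 0 < N)
    (h : p.degree < (N : WithBot ℕ)) : p.natDegree < N := by
  rcases eq_or_ne p 0 with rfl | hp
  · simpa using hN
  · exact (natDegree_lt_iff_degree_lt hp).mpr h

variable [Fintype ι]

theorem degree_le_vecDegree (v : ι → F[X]) (i : ι) : (v i).degree ≤ (vecDegree v : WithBot ℕ) :=
  degree_le_of_natDegree_le (Finset.le_sup (f := fun i => (v i).natDegree) (Finset.mem_univ i))

/-- A vector of a minimal basis cannot be exchanged for a vector of smaller degree. -/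
theorem IsMinimalBasis.exists_le_degree (hb : IsMinimalBasis V b) {w : ι → F[X]} {D : F[X]}
    (hD : D ≠ 0) {s : Fin r → F[X]} (hw : D • w = ∑ j, s j • b j) {j₀ : Fin r}
    (hs : s j₀ ≠ 0) : ∃ i, (vecDegree (b j₀) : WithBot ℕ) ≤ (w i).degree := by
  classical
  by_contra! h
  have hc := hb.toIsPolynomialBasis.update hD hw hs
  have hw0 : w ≠ 0 := fun h0 => by
    have := hc.linearIndependent_poly.ne_zero j₀
    simp [h0] at this
  obtain ⟨i, hi⟩ := Function.ne_iff.mp hw0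
  -- `vecDegree` counts zero entries as degree 0, so a strict bound on `degree` passes to it only if
  -- the bound is positive.
  have hpos : 0 < vecDegree (b j₀) := by
    have := h i
    rw [degree_eq_natDegree hi] at this
    exact lt_of_le_of_lt (Nat.zero_le _) (Nat.cast_lt.mp this)
  have hlt : vecDegree w < vecDegree (b j₀) := by
    rw [vecDegree, Finset.sup_lt_iff (by simpa using hpos)]
    exact fun i _ => natDegree_lt_of_degree_lt hpos (h i)
  refine absurd (hb.sum_le _ hc) (not_le.mpr (Finset.sum_lt_sum (fun j _ => ?_)
    ⟨j₀, Finset.mem_univ _, by simpa using hlt⟩))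
  rcases eq_or_ne j j₀ with rfl | hj
  · simpa using hlt.le
  · simp [hj]

/-- Cancelling deg D makes every entry of w of smaller degree than b_{j₀}, against minimality. The
bound is put on D w because that is the combination whose degree division with remainder controls.
-/
theorem IsMinimalBasis.false_of_degree_lt (hb : IsMinimalBasis V b) {w : ι → F[X]} {D : F[X]}
    (hD : D ≠ 0) {s : Fin r → F[X]} (hw : D • w = ∑ j, s j • b j) {j₀ : Fin r}
    (hs : s j₀ ≠ 0)
    (hdeg : ∀ i, (D * w i).degree < ((D.natDegree + vecDegree (b j₀) : ℕ) : WithBot ℕ)) :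
    False := by
  obtain ⟨i, hi⟩ := hb.exists_le_degree hD hw hs
  refine absurd (hdeg i) (not_lt.mpr ?_)
  rw [degree_mul, degree_eq_natDegree hD, Nat.cast_add]
  gcongr

theorem degree_sum_smul_lt {a : Fin r → F[X]} {N : ℕ} (i : ι)
    (h : ∀ j, a j ≠ 0 → (a j).natDegree + vecDegree (b j) < N) :
    ((∑ j, a j • b j) i).degree < (N : WithBot ℕ) := by
  rw [Finset.sum_apply]
  refine (degree_sum_le _ _).trans_lt ((Finset.sup_lt_iff (WithBot.bot_lt_coe N)).mpr ?_)
  intro j _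
  rcases eq_or_ne (a j) 0 with h0 | h0
  · simp [h0]
  · rw [Pi.smul_apply, smul_eq_mul, degree_mul]
    calc _ ≤ ((a j).natDegree : WithBot ℕ) + (vecDegree (b j) : WithBot ℕ) := by
          gcongr
          · exact degree_le_natDegree
          · exact degree_le_vecDegree _ _
      _ = ((((a j).natDegree + vecDegree (b j) : ℕ)) : WithBot ℕ) := by push_cast; rfl
      _ < N := Nat.cast_lt.mpr (h j h0)

/-- A minimal basis of `V` generates the module of polynomial vectors of `V`. -/
theorem IsMinimalBasis.exists_eq_sum (hb : IsMinimalBasis V b) {v : ι → F[X]}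
    (hv : toRat v ∈ V) : ∃ q : Fin r → F[X], v = ∑ j, q j • b j := by
  obtain ⟨D, hD, a, ha⟩ := hb.exists_smul_eq hv
  have hDw : D • (v - ∑ j, (a j / D) • b j) = ∑ j, (a j % D) • b j := by
    rw [smul_sub, ha, Finset.smul_sum, ← Finset.sum_sub_distrib]
    refine Finset.sum_congr rfl fun j _ => ?_
    rw [smul_smul, ← sub_smul]
    congr 1
    rw [sub_eq_iff_eq_add, add_comm]
    exact (EuclideanDomain.div_add_mod (a j) D).symm
  by_cases hs : ∀ j, a j % D = 0
  · refine ⟨fun j => a j / D, ?_⟩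
    simp only [hs, zero_smul, Finset.sum_const_zero, smul_eq_zero, hD, false_or] at hDw
    exact sub_eq_zero.mp hDw
  · exfalso
    push Not at hs
    obtain ⟨j₁, hj₁⟩ := hs
    classical
    -- All remainders have degree < deg D, so choosing b_{j₀} of largest degree among the nonzero
    -- ones bounds every term by deg D + deg b_{j₀}.
    obtain ⟨j₀, hj₀, hmax⟩ := (Finset.univ.filter fun j => a j % D ≠ 0).exists_max_image
      (fun j => vecDegree (b j)) ⟨j₁, by simpa using hj₁⟩
    simp only [Finset.mem_filter, Finset.mem_univ, true_and] at hj₀ hmax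
    refine hb.false_of_degree_lt hD hDw hj₀ fun i => ?_
    have : D * (v - ∑ j, (a j / D) • b j) i = (∑ j, (a j % D) • b j) i := by
      rw [← hDw]; rfl
    rw [this]
    refine degree_sum_smul_lt i fun j hj => ?_
    exact add_lt_add_of_lt_of_le (natDegree_lt_natDegree hj (EuclideanDomain.mod_lt _ hD))
      (hmax j hj)

/-- The predictable degree property of minimal bases. -/
theorem IsMinimalBasis.natDegree_add_lt (hb : IsMinimalBasis V b) {q : Fin r → F[X]} {k : ℕ}
    (hk : ∀ i, ((∑ j, q j • b j) i).degree < (k : WithBot ℕ)) (j : Fin r) (hj : q j ≠ 0) :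
    (q j).natDegree + vecDegree (b j) < k := by
  classical
  by_contra hcon
  obtain ⟨j₀, hj₀, hmax⟩ := (Finset.univ.filter fun j => q j ≠ 0 ∧
    k ≤ (q j).natDegree + vecDegree (b j)).exists_max_image
      (fun j => vecDegree (b j)) ⟨j, by simpa using ⟨hj, not_lt.mp hcon⟩⟩
  simp only [Finset.mem_filter, Finset.mem_univ, true_and] at hj₀ hmax
  -- Truncating the q_j below order N keeps a nonzero coefficient at j₀. Then X^N w is the given
  -- sum, of degree < k ≤ N + deg b_{j₀}, minus the terms (q_l mod X^N) b_l. These also stay below N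
  -- + deg b_{j₀}: by the maximal choice of j₀ if l violates the claim, and because they stay below
  -- k otherwise.
  set N := (q j₀).natDegree with hN
  set w := ∑ j, (q j / X ^ N) • b j with hw
  have hX : (X ^ N : F[X]) ≠ 0 := pow_ne_zero _ X_ne_zero
  have hw' : (X ^ N : F[X]) • w = ∑ j, (X ^ N * (q j / X ^ N)) • b j := by
    simp only [hw, Finset.smul_sum, smul_smul]
  have hw'' : (X ^ N : F[X]) • w = ∑ j, q j • b j - ∑ j, (q j % X ^ N) • b j := by
    rw [hw', ← Finset.sum_sub_distrib]
    refine Finset.sum_congr rfl fun j _ => ?_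
    rw [← sub_smul]
    congr 1
    rw [eq_sub_iff_add_eq]
    exact EuclideanDomain.div_add_mod (q j) _
  refine hb.false_of_degree_lt hX hw' (j₀ := j₀) ?_ fun i => ?_
  · refine mul_ne_zero hX fun h0 => ?_
    rw [Polynomial.div_eq_zero_iff hX, degree_X_pow, degree_eq_natDegree hj₀.1] at h0
    exact lt_irrefl _ h0
  · have : (X ^ N : F[X]) * w i = (∑ j, q j • b j) i - (∑ j, (q j % X ^ N) • b j) i := by
      rw [← Pi.sub_apply, ← hw'']; rfl
    rw [this, natDegree_X_pow]
    refine (degree_sub_le _ _).trans_lt (max_lt ((hk i).trans_le (Nat.cast_le.mpr hj₀.2)) ?_)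
    refine degree_sum_smul_lt i fun l hl => ?_
    have h1 : (q l % X ^ N).natDegree < N := by
      have := natDegree_lt_natDegree hl (EuclideanDomain.mod_lt (q l) hX)
      rwa [natDegree_X_pow] at this
    have hl0 : q l ≠ 0 := fun h0 => hl (by rw [h0]; exact EuclideanDomain.zero_mod _)
    by_cases hlk : k ≤ (q l).natDegree + vecDegree (b l)
    · exact add_lt_add_of_lt_of_le h1 (hmax l ⟨hl0, hlk⟩)
    · have h2 : (q l % X ^ N).natDegree ≤ (q l).natDegree :=
by
        rw [← modByMonic_eq_mod _ (monic_X_pow N)]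
        exact natDegree_modByMonic_le_left
      omega

/-- The combinations of a minimal basis with coefficients of suitable degrees are the polynomial
vectors of bounded degree. -/
theorem IsMinimalBasis.finrank_polyVectorsLT (hb : IsMinimalBasis V b) (k : ℕ) :
    Module.finrank F (polyVectorsLT V k) = ∑ j, (k - vecDegree (b j)) := by
  let f : ((j : Fin r) → degreeLT F (k - vecDegree (b j))) →ₗ[F] polyVectorsLT V k :=
    { toFun := fun q => ⟨∑ j, (q j : F[X]) • b j, mem_polyVectorsLT.mpr ⟨hb.sum_smul_mem _,
        fun i => degree_sum_smul_lt i fun j => mem_degreeLT_sub.mp (q j).2⟩⟩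
      map_add' := fun p q => by
        ext1
        simp [add_smul, Finset.sum_add_distrib]
      map_smul' := fun c q => by
        ext1
        simp [Finset.smul_sum] }
  have hf : Function.Bijective f := by
    constructor
    · rw [← LinearMap.ker_eq_bot, LinearMap.ker_eq_bot']
      intro q hq
      have := Fintype.linearIndependent_iff.mp hb.linearIndependent_poly (fun j => (q j : F[X]))
        (congrArg Subtype.val hq)
      funext j
      exact Subtype.ext (this j)
    · rintro ⟨v, hv⟩
      rw [mem_polyVectorsLT] at hv
      obtain ⟨q, rfl⟩ := hb.exists_eq_sum hv.1
      exact ⟨fun j => ⟨q j, mem_degreeLT_sub.mpr (hb.natDegree_add_lt hv.2 j)⟩, rfl⟩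
  have hfin : ∀ j, Module.finrank F (degreeLT F (k - vecDegree (b j))) = k - vecDegree (b j) :=
    fun j => by rw [(degreeLTEquiv F _).finrank_eq, Module.finrank_fin_fun]
  have : ∀ j, Module.Finite F (degreeLT F (k - vecDegree (b j))) := fun j =>
    Module.Finite.equiv (degreeLTEquiv F _).symm
  rw [← (LinearEquiv.ofBijective f hf).finrank_eq, Module.finrank_pi_fintype]
  exact Finset.sum_congr rfl fun j _ => hfin j

theorem finrank_polyVectorsLT (V : Submodule (RatFunc F) (ι → RatFunc F)) (k : ℕ) :
    Module.finrank F (polyVectorsLT V k) = ((minimalIndices V).map fun e => k - e).sum := by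
  rw [(Classical.choose_spec (exists_isMinimalBasis V)).finrank_polyVectorsLT, minimalIndices,
    Multiset.map_map]
  rfl

theorem minimalIndices_bot : minimalIndices (⊥ : Submodule (RatFunc F) (ι → RatFunc F)) = 0 := by
  rw [← Multiset.card_eq_zero, minimalIndices, Multiset.card_map, Finset.card_val,
    Finset.card_univ, Fintype.card_fin, finrank_bot]

end MinimalBasis

/-! ### Trimmed Sylvester matrices and multiplication by a polynomial matrix -/

section Sylvester

variable {m p : ℕ}

theorem toRat_mem_ker_iff {M : Matrix (Fin m) (Fin p) F[X]} {v : Fin p → F[X]} :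
    toRat v ∈ LinearMap.ker (ratMatrix M).mulVecLin ↔ M.mulVec v = 0 := by
  have : (ratMatrix M).mulVec (toRat v) = toRat (M.mulVec v) := by
    funext i
    exact ((algebraMap F[X] (RatFunc F)).map_mulVec M v i).symm
  rw [LinearMap.mem_ker, Matrix.mulVecLin_apply, this, ← toRatHom_apply,
    map_eq_zero_iff _ toRatHom_injective]

theorem degree_mulVec_lt {d : Fin m → ℕ} {M : Matrix (Fin m) (Fin p) F[X]}
    (hM : RowDegreesLE d M) {k : ℕ} {v : Fin p → F[X]}
    (hv : ∀ j, (v j).degree < (k : WithBot ℕ)) (i : Fin m) :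
    (M.mulVec v i).degree < ((k + d i : ℕ) : WithBot ℕ) := by
  refine (degree_sum_le Finset.univ fun j => M i j * v j).trans_lt
    ((Finset.sup_lt_iff (WithBot.bot_lt_coe _)).mpr fun j _ => ?_)
  rcases eq_or_ne (v j) 0 with h0 | h0
  · simp [h0]
  · refine lt_of_le_of_lt degree_le_natDegree (Nat.cast_lt.mpr (natDegree_mul_le.trans_lt ?_))
    have h1 := (natDegree_lt_iff_degree_lt h0).mpr (hv j)
    have h2 := hM i j
    omega

/-- The coefficients of order less than `k` of a polynomial vector. -/
def coeffsLT (k : ℕ) : (Fin p → F[X]) →ₗ[F] (Fin k × Fin p → F) where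
  toFun v c := (v c.2).coeff c.1
  map_add' v w := by ext; simp
  map_smul' a v := by ext; simp

theorem coeffsLT_apply (k : ℕ) (v : Fin p → F[X]) (c : Fin k × Fin p) :
    coeffsLT k v c = (v c.2).coeff c.1 := rfl

theorem exists_coeffsLT_eq {k : ℕ} (x : Fin k × Fin p → F) :
    ∃ v : Fin p → F[X], (∀ j, (v j).degree < (k : WithBot ℕ)) ∧ coeffsLT k v = x := by
  refine ⟨fun j => ((degreeLTEquiv F k).symm fun a => x (a, j) : degreeLT F k),
    fun j => mem_degreeLT.mp (Subtype.prop _), ?_⟩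
  funext c
  exact congrFun ((degreeLTEquiv F k).apply_symm_apply fun a => x (a, c.2)) c.1

theorem eq_of_coeffsLT_eq {k : ℕ} {v w : Fin p → F[X]}
    (hv : ∀ j, (v j).degree < (k : WithBot ℕ)) (hw : ∀ j, (w j).degree < (k : WithBot ℕ))
    (h : coeffsLT k v = coeffsLT k w) : v = w := by
  funext j
  ext a
  by_cases ha : a < k
  · exact congrFun h (⟨a, ha⟩, j)
  · have hka : (k : WithBot ℕ) ≤ a := Nat.cast_le.mpr (not_lt.mp ha)
    rw [coeff_eq_zero_of_degree_lt ((hv j).trans_le hka),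
      coeff_eq_zero_of_degree_lt ((hw j).trans_le hka)]

/-- The conditional has the form of an entry of `sylvester`, so that matrix acts on coefficients by
convolution. -/
theorem coeff_mul_eq_sum_ite (f : F[X]) {g : F[X]} {k : ℕ} (hg : g.degree < (k : WithBot ℕ))
    (s : ℕ) : (f * g).coeff s =
      ∑ a : Fin k, (if (a : ℕ) ≤ s then f.coeff (s - a) else 0) * g.coeff a := by
  have hsum : g = ∑ a : Fin k, X ^ (a : ℕ) * C (g.coeff a) := by
    ext a
    by_cases ha : a < k
    · simp only [finsetSum_coeff, X_pow_mul, coeff_C_mul, coeff_X_pow]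
      rw [Finset.sum_eq_single ⟨a, ha⟩]
      · simp
      · intro b _ hb
        rw [if_neg fun h => hb (Fin.ext h.symm), mul_zero]
      · simp
    · simp only [finsetSum_coeff, X_pow_mul, coeff_C_mul, coeff_X_pow]
      rw [coeff_eq_zero_of_degree_lt (hg.trans_le (Nat.cast_le.mpr (not_lt.mp ha))),
        Finset.sum_eq_zero]
      intro b _
      rw [if_neg (by have := b.2; omega), mul_zero]
  conv_lhs => rw [hsum, Finset.mul_sum, finsetSum_coeff]
  refine Finset.sum_congr rfl fun a _ => ?_
  rw [← mul_assoc, coeff_mul_C, coeff_mul_X_pow']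

theorem trimmedSylvester_mulVec_coeffsLT (d : Fin m → ℕ) (M : Matrix (Fin m) (Fin p) F[X])
    {k : ℕ} {v : Fin p → F[X]} (hv : ∀ j, (v j).degree < (k : WithBot ℕ))
    (s : {s : Fin (k + maxDegree d) × Fin m // (s.1 : ℕ) < k + d s.2}) :
    (trimmedSylvester d k M).mulVec (coeffsLT k v) s = (M.mulVec v s.1.2).coeff s.1.1 := by
  simp only [Matrix.mulVec, dotProduct, finsetSum_coeff, trimmedSylvester, sylvester,
    Matrix.submatrix_apply, Matrix.of_apply, id_eq, coeffsLT_apply]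
  rw [Fintype.sum_prod_type_right]
  exact Finset.sum_congr rfl fun j _ => (coeff_mul_eq_sum_ite (M s.1.2 j) (hv j) s.1.1).symm

theorem le_maxDegree (d : Fin m → ℕ) (i : Fin m) : d i ≤ maxDegree d :=
  Finset.le_sup (Finset.mem_univ i)

/-- Trimming loses nothing: the rows kept for i are the orders below k + d_i, and neither side has
coefficients beyond them. -/
theorem trimmedSylvester_mulVec_eq_iff {d : Fin m → ℕ} {M : Matrix (Fin m) (Fin p) F[X]}
    (hM : RowDegreesLE d M) {k : ℕ} {v : Fin p → F[X]}
    (hv : ∀ j, (v j).degree < (k : WithBot ℕ)) {y : Fin m → F[X]}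
    (hy : ∀ i, (y i).degree < ((k + d i : ℕ) : WithBot ℕ)) :
    ((trimmedSylvester d k M).mulVec (coeffsLT k v) = fun s => (y s.1.2).coeff s.1.1) ↔
      M.mulVec v = y := by
  constructor
  · intro h
    funext i
    ext a
    by_cases ha : a < k + d i
    · have := congrFun h ⟨(⟨a, by have := le_maxDegree d i; omega⟩, i), ha⟩
      rwa [trimmedSylvester_mulVec_coeffsLT d M hv] at this
    · have hka : ((k + d i : ℕ) : WithBot ℕ) ≤ a := Nat.cast_le.mpr (not_lt.mp ha)
      rw [coeff_eq_zero_of_degree_lt ((degree_mulVec_lt hM hv i).trans_le hka),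
        coeff_eq_zero_of_degree_lt ((hy i).trans_le hka)]
  · rintro rfl
    funext s
    exact trimmedSylvester_mulVec_coeffsLT d M hv s

/-- Taking coefficients is injective on vectors of degree < k and carries the polynomial null
vectors onto this kernel. -/
theorem finrank_ker_trimmedSylvester {d : Fin m → ℕ} {M : Matrix (Fin m) (Fin p) F[X]}
    (hM : RowDegreesLE d M) (k : ℕ) :
    Module.finrank F (LinearMap.ker (trimmedSylvester d k M).mulVecLin) =
      ((rightMinimalIndices M).map fun e => k - e).sum := by
  rw [rightMinimalIndices, ← finrank_polyVectorsLT]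
  set W := polyVectorsLT (LinearMap.ker (ratMatrix M).mulVecLin) k with hW
  have hz : ∀ i : Fin m, ((0 : Fin m → F[X]) i).degree < ((k + d i : ℕ) : WithBot ℕ) :=
    fun i => by simp
  have hmem : ∀ v : Fin p → F[X], v ∈ W ↔
      (∀ j, (v j).degree < (k : WithBot ℕ)) ∧ M.mulVec v = 0 := fun v => by
    rw [hW, mem_polyVectorsLT, toRat_mem_ker_iff, and_comm]
  have hinj : Function.Injective ((coeffsLT k).domRestrict W) := fun v w h =>
    Subtype.ext (eq_of_coeffsLT_eq ((hmem v).mp v.2).1 ((hmem w).mp w.2).1 h)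
  rw [← LinearMap.finrank_range_of_inj hinj]
  suffices h : LinearMap.ker (trimmedSylvester d k M).mulVecLin =
      LinearMap.range ((coeffsLT k).domRestrict W) by rw [h]
  ext x
  obtain ⟨v, hv, rfl⟩ := exists_coeffsLT_eq x
  have hiff := trimmedSylvester_mulVec_eq_iff hM hv hz
  simp only [Pi.zero_apply, coeff_zero] at hiff
  rw [LinearMap.mem_ker, Matrix.mulVecLin_apply]
  refine hiff.trans ⟨fun h => ⟨⟨v, (hmem v).mpr ⟨hv, h⟩⟩, rfl⟩, ?_⟩
  rintro ⟨⟨w, hw⟩, h⟩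
  rw [hmem] at hw
  rw [← eq_of_coeffsLT_eq hw.1 hv h, hw.2]

theorem rank_trimmedSylvester_add {d : Fin m → ℕ} {M : Matrix (Fin m) (Fin p) F[X]}
    (hM : RowDegreesLE d M) (k : ℕ) :
    (trimmedSylvester d k M).rank + ((rightMinimalIndices M).map fun e => k - e).sum = k * p := by
  rw [← finrank_ker_trimmedSylvester hM, Matrix.rank, LinearMap.finrank_range_add_finrank_ker,
    Module.finrank_fintype_fun_eq_card, Fintype.card_prod, Fintype.card_fin, Fintype.card_fin]

theorem card_trimmedSylvester_rows (d : Fin m → ℕ) (k : ℕ) :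
    Fintype.card {s : Fin (k + maxDegree d) × Fin m // (s.1 : ℕ) < k + d s.2} =
      k * m + ∑ i, d i := by
  have e : {s : Fin (k + maxDegree d) × Fin m // (s.1 : ℕ) < k + d s.2} ≃
      (i : Fin m) × Fin (k + d i) :=
    { toFun := fun s => ⟨s.1.2, ⟨s.1.1, s.2⟩⟩
      invFun := fun s => ⟨(⟨s.2, by
        have := le_maxDegree d s.1
        have := s.2.2
        omega⟩, s.1), s.2.2⟩
      left_inv := fun s => rfl
      right_inv := fun s => rfl }
  rw [Fintype.card_congr e, Fintype.card_sigma]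
  simp [Finset.sum_add_distrib, mul_comm]

/-- If a trimmed Sylvester matrix has full row rank, then multiplication by `M` is surjective in
the corresponding degrees. -/
theorem exists_mulVec_eq {d : Fin m → ℕ} {M : Matrix (Fin m) (Fin p) F[X]}
    (hM : RowDegreesLE d M) {k : ℕ}
    (hk : (trimmedSylvester d k M).rank = k * m + ∑ i, d i) {y : Fin m → F[X]}
    (hy : ∀ i, (y i).degree < ((k + d i : ℕ) : WithBot ℕ)) :
    ∃ v : Fin p → F[X], (∀ j, (v j).degree < (k : WithBot ℕ)) ∧ M.mulVec v = y := by
  have htop : LinearMap.range (trimmedSylvester d k M).mulVecLin = ⊤ := by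
    apply Submodule.eq_top_of_finrank_eq
    rw [Module.finrank_fintype_fun_eq_card, card_trimmedSylvester_rows, ← hk, Matrix.rank]
  obtain ⟨x, hx⟩ := LinearMap.range_eq_top.mp htop fun s => (y s.1.2).coeff s.1.1
  obtain ⟨v, hv, rfl⟩ := exists_coeffsLT_eq x
  exact ⟨v, hv, (trimmedSylvester_mulVec_eq_iff hM hv hy).mp hx⟩

theorem exists_mul_eq_one_of_mulVec {R : Type*} [CommRing R] {M : Matrix (Fin m) (Fin p) R}
    (h : ∀ i, ∃ v, M.mulVec v = Pi.single i 1) : ∃ N : Matrix (Fin p) (Fin m) R, M * N = 1 := by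
  choose v hv using h
  refine ⟨Matrix.of fun j i => v i j, ?_⟩
  ext a i
  rw [Matrix.one_apply, ← Pi.single_apply, ← hv i]
  rfl

/-- The matrix of the coefficients of order `d i` in the rows of `M`. -/
def leadingRows (d : Fin m → ℕ) (M : Matrix (Fin m) (Fin p) F[X]) : Matrix (Fin m) (Fin p) F :=
  Matrix.of fun i j => (M i j).coeff (d i)

theorem exists_right_inverse {d : Fin m → ℕ} {M : Matrix (Fin m) (Fin p) F[X]}
    (hM : RowDegreesLE d M) {k : ℕ} (hk1 : 1 ≤ k)
    (hk : (trimmedSylvester d k M).rank = k * m + ∑ i, d i) :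
    ∃ N : Matrix (Fin p) (Fin m) F[X], M * N = 1 := by
  refine exists_mul_eq_one_of_mulVec fun i => ?_
  obtain ⟨v, -, hv⟩ := exists_mulVec_eq hM hk (y := Pi.single i 1) fun l => by
    rw [Pi.single_apply]
    split_ifs
    · rw [degree_one]
      exact_mod_cast (by omega : 0 < k + d l)
    · simp
  exact ⟨v, hv⟩

theorem exists_leadingRows_right_inverse {d : Fin m → ℕ} {M : Matrix (Fin m) (Fin p) F[X]}
    (hM : RowDegreesLE d M) {k : ℕ} (hk1 : 1 ≤ k)
    (hk : (trimmedSylvester d k M).rank = k * m + ∑ i, d i) :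
    ∃ N : Matrix (Fin p) (Fin m) F, leadingRows d M * N = 1 := by
  obtain ⟨k, rfl⟩ : ∃ l, k = l + 1 := ⟨k - 1, by omega⟩
  refine exists_mul_eq_one_of_mulVec fun i => ?_
  -- With k now shifted by one, d l + k is the highest order allowed in entry l. As deg v ≤ k, the
  -- coefficient of M v there involves only the leading row coefficients and the order-k
  -- coefficients of v.
  obtain ⟨v, hv, hMv⟩ := exists_mulVec_eq hM hk
    (y := fun l => C ((Pi.single i 1 : Fin m → F) l) * X ^ (d l + k)) fun l =>
      (degree_C_mul_X_pow_le _ _).trans_lt (Nat.cast_lt.mpr (by omega))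
  refine ⟨fun j => (v j).coeff k, ?_⟩
  funext l
  have h := congrArg (fun f => coeff f (d l + k)) (congrFun hMv l)
  simp only [Matrix.mulVec, dotProduct, finsetSum_coeff, coeff_C_mul, coeff_X_pow, if_true,
    mul_one] at h
  rw [← h, Matrix.mulVec, dotProduct]
  refine Finset.sum_congr rfl fun j _ => ?_
  rw [coeff_mul_add_eq_of_natDegree_le (hM l j)]
  · rfl
  · exact Nat.lt_succ_iff.mp (natDegree_lt_of_degree_lt k.succ_pos (hv j))

end Sylvester

/-! ### Minors and elementary divisors -/

section Minors

open Classical in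
/-- The maximal minors of a right invertible matrix generate the unit ideal. -/
theorem span_minors_eq_top {R : Type*} [CommRing R] {k p : ℕ} {A : Matrix (Fin k) (Fin p) R}
    {B : Matrix (Fin p) (Fin k) R} (h : A * B = 1) :
    Ideal.span (Set.range fun c : Fin k ↪o Fin p => (A.submatrix id c).det) = ⊤ := by
  set I := Ideal.span (Set.range fun c : Fin k ↪o Fin p => (A.submatrix id c).det) with hI
  -- An arbitrary choice of columns either repeats one, giving 0, or permutes an increasing choice,
  -- changing only the sign.
  have hminor : ∀ g : Fin k → Fin p, (A.submatrix id g).det ∈ I := by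
    intro g
    by_cases hg : Function.Injective g
    · let s : Finset (Fin p) := Finset.univ.image g
      have hs : s.card = k := by
        rw [Finset.card_image_of_injective _ hg, Finset.card_univ, Fintype.card_fin]
      have hmem : ∀ i, ∃ l, s.orderEmbOfFin hs l = g i := fun i => by
        have : g i ∈ Set.range (s.orderEmbOfFin hs) := by
          rw [Finset.range_orderEmbOfFin]
          exact Finset.mem_coe.mpr (Finset.mem_image_of_mem _ (Finset.mem_univ i))
        exact this
      choose τ hτ using hmem
      have hinj : Function.Injective τ := fun a b hab => hg (by rw [← hτ, ← hτ, hab])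
      let e : Equiv.Perm (Fin k) := Equiv.ofBijective τ (Finite.injective_iff_bijective.mp hinj)
      have : A.submatrix id g = (A.submatrix id (s.orderEmbOfFin hs)).submatrix id e := by
        ext a b
        simp only [Matrix.submatrix_apply, id_eq]
        rw [← hτ b]
        rfl
      rw [this, Matrix.det_permute']
      exact I.mul_mem_left _ (Ideal.subset_span ⟨_, rfl⟩)
    · rw [Function.not_injective_iff] at hg
      obtain ⟨a, b, hab, hne⟩ := hg
      rw [Matrix.det_zero_of_column_eq hne fun i => by simp [hab]]
      exact I.zero_mem
  rw [Ideal.eq_top_iff_one, ← Matrix.det_one (n := Fin k) (R := R), ← h, ← Matrix.det_transpose]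
  -- Columns of AB are combinations of columns of A, so multilinearity expands det(AB) = 1 into
  -- minors of A, as in Cauchy–Binet.
  have hrow : (A * B).transpose = fun l => ∑ j, B j l • A.transpose j := by
    ext l i
    simp [Matrix.mul_apply, Finset.sum_apply, mul_comm]
  have hdet : (A * B).transpose.det =
      Matrix.detRowAlternating (R := R) (fun l => ∑ j, B j l • A.transpose j) := by
    rw [← hrow]; rfl
  rw [hdet, ← AlternatingMap.coe_multilinearMap, MultilinearMap.map_sum]
  refine I.sum_mem fun g _ => ?_
  rw [MultilinearMap.map_smul_univ, smul_eq_mul]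
  refine I.mul_mem_left _ ?_
  have := hminor g
  rwa [← Matrix.det_transpose] at this

theorem exists_minor_ne_zero {R : Type*} [CommRing R] [Nontrivial R] {k p : ℕ}
    {A : Matrix (Fin k) (Fin p) R} {B : Matrix (Fin p) (Fin k) R} (h : A * B = 1) :
    ∃ c : Fin k ↪o Fin p, (A.submatrix id c).det ≠ 0 := by
  by_contra! hc
  have := span_minors_eq_top h
  simp only [hc] at this
  exact bot_ne_top ((Ideal.span_eq_bot.mpr (by rintro _ ⟨c, rfl⟩; rfl)).symm.trans this)

theorem submatrix_mul_eq_one {R : Type*} [CommRing R] {m k p : ℕ}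
    {A : Matrix (Fin m) (Fin p) R} {B : Matrix (Fin p) (Fin m) R} (h : A * B = 1)
    {c : Fin k → Fin m} (hc : Function.Injective c) :
    A.submatrix c id * B.submatrix id c = 1 := by
  rw [← Matrix.submatrix_mul A B c id c Function.bijective_id, h, Matrix.submatrix_one _ hc]

variable {m p : ℕ}

/-- The ideal generated by the minors of order `k`. -/
def minorsIdeal (P : Matrix (Fin m) (Fin p) F[X]) (k : ℕ) : Ideal F[X] :=
  Ideal.span (Set.range fun rc : (Fin k ↪o Fin m) × (Fin k ↪o Fin p) =>
    (P.submatrix rc.1 rc.2).det)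

theorem minor_mem_minorsIdeal (P : Matrix (Fin m) (Fin p) F[X]) {k : ℕ} (r : Fin k ↪o Fin m)
    (c : Fin k ↪o Fin p) : (P.submatrix r c).det ∈ minorsIdeal P k :=
  Ideal.subset_span ⟨(r, c), rfl⟩

theorem determinantalDivisor_dvd_iff {P : Matrix (Fin m) (Fin p) F[X]} {k : ℕ} {f : F[X]} :
    determinantalDivisor P k ∣ f ↔ f ∈ minorsIdeal P k := by
  classical
  rw [determinantalDivisor, normalize_dvd_iff, minorsIdeal,
    Submodule.IsPrincipal.mem_iff_generator_dvd]

theorem dvd_determinantalDivisor_iff {P : Matrix (Fin m) (Fin p) F[X]} {k : ℕ} {f : F[X]} :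
    f ∣ determinantalDivisor P k ↔
      ∀ (r : Fin k ↪o Fin m) (c : Fin k ↪o Fin p), f ∣ (P.submatrix r c).det := by
  constructor
  · exact fun h r c => h.trans (determinantalDivisor_dvd_iff.mpr (minor_mem_minorsIdeal P r c))
  · intro h
    have hle : minorsIdeal P k ≤ Ideal.span {f} := by
      rw [minorsIdeal, Ideal.span_le]
      rintro _ ⟨rc, rfl⟩
      exact Ideal.mem_span_singleton.mpr (h rc.1 rc.2)
    exact Ideal.mem_span_singleton.mp (hle (determinantalDivisor_dvd_iff.mp dvd_rfl))

/-- Laplace expansion along the first row. -/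
theorem determinantalDivisor_dvd_succ (P : Matrix (Fin m) (Fin p) F[X]) (k : ℕ) :
    determinantalDivisor P k ∣ determinantalDivisor P (k + 1) := by
  rw [dvd_determinantalDivisor_iff]
  intro r c
  rw [Matrix.det_succ_row_zero]
  refine Finset.dvd_sum fun j _ => Dvd.dvd.mul_left ?_ _
  rw [determinantalDivisor_dvd_iff, Matrix.submatrix_submatrix]
  exact minor_mem_minorsIdeal P ((Fin.succOrderEmb k).trans r)
    ((Fin.succAboveOrderEmb j).trans c)

open Classical in
theorem normalize_determinantalDivisor (P : Matrix (Fin m) (Fin p) F[X]) (k : ℕ) :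
    normalize (determinantalDivisor P k) = determinantalDivisor P k :=
  normalize_idem _

open Classical in
-- The first k rows of P are right invertible by the first k columns of N, so their minors alone
-- generate the unit ideal.
theorem determinantalDivisor_eq_one {P : Matrix (Fin m) (Fin p) F[X]}
    {N : Matrix (Fin p) (Fin m) F[X]} (h : P * N = 1) {k : ℕ} (hk : k ≤ m) :
    determinantalDivisor P k = 1 := by
  have hu : IsUnit (determinantalDivisor P k) := by
    rw [isUnit_iff_dvd_one, determinantalDivisor_dvd_iff, ← Ideal.eq_top_iff_one, eq_top_iff,
      ← span_minors_eq_top (submatrix_mul_eq_one h (Fin.castLEOrderEmb hk).injective),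
      Ideal.span_le]
    rintro _ ⟨c, rfl⟩
    exact minor_mem_minorsIdeal P (Fin.castLEOrderEmb hk) c
  exact (normalize_determinantalDivisor P k).symm.trans (normalize_eq_one.mpr hu)

theorem normalRank_le (P : Matrix (Fin m) (Fin p) F[X]) : normalRank P ≤ m :=
  (Matrix.rank_le_card_height _).trans_eq (Fintype.card_fin m)

open Classical in
theorem elementaryDivisors_eq_zero {P : Matrix (Fin m) (Fin p) F[X]}
    {N : Matrix (Fin p) (Fin m) F[X]} (h : P * N = 1) : elementaryDivisors P = 0 := by
  rw [elementaryDivisors]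
  refine Finset.sum_eq_zero fun k hk => ?_
  have hkm : k + 1 ≤ m := (Finset.mem_range.mp hk).trans_le (normalRank_le P)
  rw [invariantPolynomial, determinantalDivisor_eq_one h hkm,
    determinantalDivisor_eq_one h (by omega), EuclideanDomain.div_one, primePowerFactors,
    @UniqueFactorizationMonoid.normalizedFactors_one]
  rfl

theorem leftMinimalIndices_eq_zero {P : Matrix (Fin m) (Fin p) F[X]}
    {N : Matrix (Fin p) (Fin m) F[X]} (h : P * N = 1) : leftMinimalIndices P = 0 := by
  have hker : LinearMap.ker (ratMatrix P).vecMulLinear = ⊥ := by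
    rw [LinearMap.ker_eq_bot']
    intro v hv
    rw [Matrix.vecMulLinear_apply] at hv
    have hPN : ratMatrix P * N.map (algebraMap F[X] (RatFunc F)) = 1 := by
      rw [ratMatrix, ← Matrix.map_mul, h, Matrix.map_one _ (map_zero _) (map_one _)]
    rw [← Matrix.vecMul_one v, ← hPN, ← Matrix.vecMul_vecMul, hv, Matrix.zero_vecMul]
  rw [leftMinimalIndices, hker, minimalIndices_bot]

theorem normalRank_eq_of_minor_ne_zero {P : Matrix (Fin m) (Fin p) F[X]} {c : Fin m ↪o Fin p}
    (hc : (P.submatrix id c).det ≠ 0) : normalRank P = m := by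
  refine le_antisymm (normalRank_le P) ?_
  have hdet : ((ratMatrix P).submatrix id c).det ≠ 0 := by
    have : (ratMatrix P).submatrix id c =
        (algebraMap F[X] (RatFunc F)).mapMatrix (P.submatrix id c) := rfl
    rw [this, ← RingHom.map_det]
    simpa using hc
  have := Matrix.rank_of_isUnit _ ((Matrix.isUnit_iff_isUnit_det _).mpr hdet.isUnit)
  rw [Fintype.card_fin] at this
  rw [normalRank]
  conv_lhs => rw [← this]
  exact Matrix.rank_submatrix_le _ _ _

end Minors

/-! ### Infinite elementary divisors -/

section Infinite

variable {m p : ℕ}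

theorem _root_.Fin.val_le_val_of_strictMono {k m : ℕ} {f : Fin k → Fin m} (hf : StrictMono f)
    (j : Fin k) : (j : ℕ) ≤ f j := by
  obtain ⟨j, hj⟩ := j
  induction j with
  | zero => exact Nat.zero_le _
  | succ j ih =>
    have h1 := ih (by omega)
    have h2 : f ⟨j, by omega⟩ < f ⟨j + 1, hj⟩ := hf (Fin.mk_lt_mk.mpr j.lt_succ_self)
    exact Nat.succ_le_of_lt (h1.trans_lt h2)

/-- The sum of the values of a sequence on `k` indices is at least the sum of its `k` smallest
values. -/
theorem sum_sort_le (e : Fin m → ℕ) {k : ℕ} (hk : k ≤ m) (r : Fin k ↪o Fin m) :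
    ∑ j, e (Tuple.sort e (Fin.castLE hk j)) ≤ ∑ j, e (r j) := by
  classical
  set σ := Tuple.sort e with hσ
  -- These are the positions of the chosen indices in sorted order; the j-th smallest position is at
  -- least j.
  let s : Finset (Fin m) := Finset.univ.image fun j => σ.symm (r j)
  have hinj : Function.Injective fun j => σ.symm (r j) := σ.symm.injective.comp r.injective
  have hs : s.card = k := by
    rw [Finset.card_image_of_injective _ hinj, Finset.card_univ, Fintype.card_fin]
  have hsum : ∑ j, e (r j) = ∑ j, e (σ (s.orderEmbOfFin hs j)) := by
    calc ∑ j, e (r j) = ∑ i ∈ s, e (σ i) := by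
          rw [Finset.sum_image hinj.injOn]
          simp
      _ = _ := by
          conv_lhs => rw [← Finset.map_orderEmbOfFin_univ s hs, Finset.sum_map]
          rfl
  rw [hsum]
  refine Finset.sum_le_sum fun j _ => Tuple.monotone_sort e ?_
  exact Fin.val_le_val_of_strictMono (s.orderEmbOfFin hs).strictMono j

open Classical in
-- A monic irreducible q with X ∣ q^c is X itself, so at most the single factor X^e survives.
theorem filter_primePowerFactors {Q : F[X]} (hQ : Q ≠ 0) {e : ℕ}
    (he : emultiplicity X Q = (e : ℕ∞)) :
    (primePowerFactors Q).filter (fun q => X ∣ q) = if 0 < e then {X ^ e} else 0 := by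
  set S := UniqueFactorizationMonoid.normalizedFactors Q with hS
  have hnX : normalize (X : F[X]) = X := monic_X.normalize_eq_self
  have hcount : S.count X = e := by
    have h := UniqueFactorizationMonoid.emultiplicity_eq_count_normalizedFactors
      (irreducible_X (R := F)) hQ
    rw [he, hnX] at h
    exact_mod_cast h.symm
  have hfilter : S.toFinset.val.filter (fun q => X ∣ q ^ S.count q) =
      (S.toFinset.filter fun q => q = X).val := by
    rw [Finset.filter_val]
    refine Multiset.filter_congr fun q hq => ?_
    have hqS : q ∈ S := Multiset.mem_toFinset.mp hq
    constructor
    · intro h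
      have hdvd := prime_X.dvd_of_dvd_pow h
      have := (irreducible_X (R := F)).associated_of_dvd
        (UniqueFactorizationMonoid.irreducible_of_normalized_factor q hqS) hdvd
      rw [← UniqueFactorizationMonoid.normalize_normalized_factor q hqS, ← hnX]
      exact (normalize_eq_normalize_iff_associated.mpr this).symm
    · rintro rfl
      exact dvd_pow_self _ (Multiset.count_pos.mpr hqS).ne'
  rw [primePowerFactors, Multiset.filter_map, ← hS]
  refine (congrArg (Multiset.map fun q => q ^ S.count q) hfilter).trans ?_
  rw [Finset.filter_eq']
  have hmem : X ∈ S.toFinset ↔ 0 < e := by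
    rw [Multiset.mem_toFinset, ← Multiset.count_pos, hcount]
  simp only [hmem]
  split_ifs <;> simp [hcount]

/-- The row-wise reversal of `M`. -/
def rowRev (d : Fin m → ℕ) (M : Matrix (Fin m) (Fin p) F[X]) : Matrix (Fin m) (Fin p) F[X] :=
  Matrix.of fun i j => reflect (d i) (M i j)

theorem reflect_eq_X_pow_mul {f : F[X]} {a D : ℕ} (hf : f.natDegree ≤ a) (ha : a ≤ D) :
    reflect D f = X ^ (D - a) * reflect a f := by
  -- Writing f = f · 1, with 1 treated as having degree at most D - a, turns the surplus D - a into
  -- the power of X.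
  have h := reflect_mul f 1 hf (G := D - a) (by simp)
  rwa [mul_one, reflect_one, Nat.add_sub_cancel' ha, mul_comm] at h

/-- Row i of the reversal is X^(d - d_i) times row i of `rowRev`; the powers come out of the
determinant. -/
theorem det_rev_submatrix {d : Fin m → ℕ} {M : Matrix (Fin m) (Fin p) F[X]}
    (hM : RowDegreesLE d M) {k : ℕ} (r : Fin k → Fin m) (c : Fin k → Fin p) :
    ((rev (maxDegree d) M).submatrix r c).det =
      X ^ (∑ j, (maxDegree d - d (r j))) * ((rowRev d M).submatrix r c).det := by
  rw [← Finset.prod_pow_eq_pow_sum, ← Matrix.det_mul_column]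
  congr 1
  ext1 a b
  exact reflect_eq_X_pow_mul (hM _ _) (le_maxDegree d _)

theorem coeff_zero_det_rowRev_submatrix (d : Fin m → ℕ) (M : Matrix (Fin m) (Fin p) F[X])
    {k : ℕ} (r : Fin k → Fin m) (c : Fin k → Fin p) :
    (((rowRev d M).submatrix r c).det).coeff 0 = ((leadingRows d M).submatrix r c).det := by
  rw [← constantCoeff_apply, RingHom.map_det]
  congr 1
  ext1 a b
  simp [rowRev, leadingRows, coeff_reflect]

/-- Every minor carries the power Σ (d - d_i) over its rows, hence at least the sum of the k
smallest. The bound is attained on the rows with the smallest values, since right invertibility of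
the leading matrix supplies a minor there whose cofactor has nonzero constant term. -/
theorem emultiplicity_X_determinantalDivisor_rev {d : Fin m → ℕ}
    {M : Matrix (Fin m) (Fin p) F[X]} (hM : RowDegreesLE d M) {N : Matrix (Fin p) (Fin m) F}
    (hN : leadingRows d M * N = 1) {k : ℕ} (hk : k ≤ m) :
    emultiplicity X (determinantalDivisor (rev (maxDegree d) M) k) =
      ((∑ j : Fin k, (maxDegree d - d (Tuple.sort (fun i => maxDegree d - d i)
        (Fin.castLE hk j))) : ℕ) : ℕ∞) := by
  set e : Fin m → ℕ := fun i => maxDegree d - d i with he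
  set σ := Tuple.sort e with hσ
  rw [emultiplicity_eq_coe]
  constructor
  · rw [dvd_determinantalDivisor_iff]
    intro r c
    rw [det_rev_submatrix hM]
    exact Dvd.dvd.mul_right (pow_dvd_pow _ (sum_sort_le e hk r)) _
  · intro hdvd
    let τ : Fin k → Fin m := fun j => σ (Fin.castLE hk j)
    have hτ : Function.Injective τ := σ.injective.comp (Fin.castLE_injective hk)
    -- τ need not be increasing, while minors are indexed by increasing row choices, so its image is
    -- enumerated again in order.
    let s : Finset (Fin m) := Finset.univ.image τ
    have hs : s.card = k := by
      rw [Finset.card_image_of_injective _ hτ, Finset.card_univ, Fintype.card_fin]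
    let r := s.orderEmbOfFin hs
    have hsum : ∑ j, e (r j) = ∑ j, e (τ j) := by
      calc ∑ j, e (r j) = ∑ i ∈ s, e i := by
            conv_rhs => rw [← Finset.map_orderEmbOfFin_univ s hs, Finset.sum_map]
            rfl
        _ = _ := Finset.sum_image hτ.injOn
    obtain ⟨c, hc⟩ := exists_minor_ne_zero (submatrix_mul_eq_one hN r.injective)
    rw [Matrix.submatrix_submatrix] at hc
    have hd := hdvd.trans (determinantalDivisor_dvd_iff.mpr
      (minor_mem_minorsIdeal (rev (maxDegree d) M) r c))
    rw [det_rev_submatrix hM, hsum, pow_succ, mul_dvd_mul_iff_left (pow_ne_zero _ X_ne_zero),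
      X_dvd_iff, coeff_zero_det_rowRev_submatrix] at hd
    exact hc hd

theorem normalRank_rev {d : Fin m → ℕ} {M : Matrix (Fin m) (Fin p) F[X]}
    (hM : RowDegreesLE d M) {N : Matrix (Fin p) (Fin m) F} (hN : leadingRows d M * N = 1) :
    normalRank (rev (maxDegree d) M) = m := by
  obtain ⟨c, hc⟩ := exists_minor_ne_zero hN
  refine normalRank_eq_of_minor_ne_zero (c := c) ?_
  rw [det_rev_submatrix hM]
  refine mul_ne_zero (pow_ne_zero _ X_ne_zero) fun h => hc ?_
  rw [← coeff_zero_det_rowRev_submatrix, h, coeff_zero]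

theorem emultiplicity_X_invariantPolynomial_rev {d : Fin m → ℕ}
    {M : Matrix (Fin m) (Fin p) F[X]} (hM : RowDegreesLE d M) {N : Matrix (Fin p) (Fin m) F}
    (hN : leadingRows d M * N = 1) (k : Fin m) :
    invariantPolynomial (rev (maxDegree d) M) k ≠ 0 ∧
      emultiplicity X (invariantPolynomial (rev (maxDegree d) M) k) =
        ((maxDegree d - d (Tuple.sort (fun i => maxDegree d - d i) k) : ℕ) : ℕ∞) := by
  have h1 := emultiplicity_X_determinantalDivisor_rev hM hN k.2.le
  have h2 := emultiplicity_X_determinantalDivisor_rev hM hN (k := (k : ℕ) + 1) k.2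
  obtain ⟨Q, hQ⟩ := determinantalDivisor_dvd_succ (rev (maxDegree d) M) k
  have hne : determinantalDivisor (rev (maxDegree d) M) (k + 1) ≠ 0 := fun h0 => by
    rw [h0, emultiplicity_zero] at h2
    exact ENat.top_ne_natCast _ h2
  rw [hQ] at hne
  rw [invariantPolynomial, hQ, mul_div_cancel_left₀ _ (left_ne_zero_of_mul hne)]
  refine ⟨right_ne_zero_of_mul hne, ?_⟩
  rw [hQ, emultiplicity_mul prime_X, h1, Fin.sum_univ_castSucc,
    Nat.cast_add] at h2
  -- Cancellation in ℕ∞ is legitimate because the common summand is finite.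
  exact (ENat.addLECancellable_natCast _).inj.mp h2

open Classical in
theorem infiniteElementaryDivisors_eq {d : Fin m → ℕ} {M : Matrix (Fin m) (Fin p) F[X]}
    (hM : RowDegreesLE d M) {N : Matrix (Fin p) (Fin m) F} (hN : leadingRows d M * N = 1) :
    infiniteElementaryDivisors (maxDegree d) M =
      (Finset.univ.filter fun i => d i < maxDegree d).val.map
        (fun i => (X : F[X]) ^ (maxDegree d - d i)) := by
  set g : Fin m → Multiset F[X] := fun i =>
    if 0 < maxDegree d - d i then {X ^ (maxDegree d - d i)} else 0 with hg
  have hfilter : ∀ (s : Finset ℕ) (f : ℕ → Multiset F[X]),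
      (∑ k ∈ s, f k).filter (fun q => X ∣ q) = ∑ k ∈ s, (f k).filter (fun q => X ∣ q) :=
    fun s f => map_sum (⟨⟨Multiset.filter (fun q : F[X] => X ∣ q), Multiset.filter_zero _⟩,
      Multiset.filter_add _⟩ : Multiset F[X] →+ Multiset F[X]) f s
  rw [infiniteElementaryDivisors, elementaryDivisors, normalRank_rev hM hN, hfilter,
    Finset.sum_range]
  calc _ = ∑ k, g (Tuple.sort (fun i => maxDegree d - d i) k) :=
        Finset.sum_congr rfl fun k _ => by
          obtain ⟨h1, h2⟩ := emultiplicity_X_invariantPolynomial_rev hM hN k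
          exact filter_primePowerFactors h1 h2
    _ = ∑ i, g i := Equiv.sum_comp _ g
    _ = ∑ i with d i < maxDegree d, {(X : F[X]) ^ (maxDegree d - d i)} := by
        rw [Finset.sum_filter]
        exact Finset.sum_congr rfl fun i _ => by simp only [hg, Nat.sub_pos_iff_lt]
    _ = _ := by
        conv_rhs => rw [← Multiset.sum_map_singleton (Multiset.map _ _), Multiset.map_map]
        rfl

end Infinite

/-! ### Multisets described by truncated differences -/

/-- The second difference of k ↦ max(k - e, 0), centred at k + 1, is 1 if e = k + 1 and 0 otherwise.
-/
theorem sum_map_sub_succ (s : Multiset ℕ) (k : ℕ) :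
    (s.map fun e => k + 2 - e).sum + (s.map fun e => k - e).sum =
      2 * (s.map fun e => k + 1 - e).sum + s.count (k + 1) := by
  induction s using Multiset.induction_on with
  | empty => simp
  | cons a s ih =>
    simp only [Multiset.map_cons, Multiset.sum_cons, Multiset.count_cons]
    split_ifs <;> omega

theorem sum_map_one_sub (s : Multiset ℕ) : (s.map fun e => 1 - e).sum = s.count 0 := by
  induction s using Multiset.induction_on with
  | empty => simp
  | cons a s ih =>
    simp only [Multiset.map_cons, Multiset.sum_cons, Multiset.count_cons]
    split_ifs <;> omega

theorem sum_map_sub_of_count {s : Multiset ℕ} {k' a c : ℕ} (hk' : 0 < k')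
    (h1 : s.count (k' - 1) = a) (h2 : s.count k' = c)
    (h3 : ∀ j, j ≠ k' - 1 → j ≠ k' → s.count j = 0) (k : ℕ) :
    (s.map fun e => k - e).sum = a * (k - (k' - 1)) + c * (k - k') := by
  have hs : s = Multiset.replicate a (k' - 1) + Multiset.replicate c k' := by
    ext j
    rw [Multiset.count_add, Multiset.count_replicate, Multiset.count_replicate]
    by_cases hj1 : j = k' - 1
    · subst hj1
      rw [if_pos rfl, if_neg (by omega), h1, add_zero]
    · by_cases hj2 : j = k'
      · subst hj2
        rw [if_neg (by omega), if_pos rfl, h2, zero_add]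
      · rw [if_neg (Ne.symm hj1), if_neg (Ne.symm hj2), h3 j hj1 hj2]
  rw [hs]
  simp

/-- The multisets of indices for which all trimmed Sylvester matrices have full rank. -/
theorem sum_map_sub_eq_iff {s : Multiset ℕ} {n k' t S : ℕ} (hS : 0 < S)
    (ht : n * k' = S + t) (htn : t < n) :
    (∀ k, 1 ≤ k → (s.map fun e => k - e).sum = n * k - S) ↔
      s.count (k' - 1) = t ∧ s.count k' = n - t ∧
        ∀ j, j ≠ k' - 1 → j ≠ k' → s.count j = 0 := by
  obtain ⟨l, rfl⟩ : ∃ l, k' = l + 1 :=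
    ⟨k' - 1, by rcases k' with _ | k' <;> simp at ht ⊢; omega⟩
  -- At integers, max(nk - S, 0) is 0 up to l = k' - 1, because nl = S + t - n < S; it is t at l + 1
  -- and has slope n from there on.
  have hval : ∀ k, n * k - S = t * (k - l) + (n - t) * (k - (l + 1)) := by
    intro k
    obtain ⟨u, rfl⟩ : ∃ u, n = t + u := ⟨n - t, by omega⟩
    rw [Nat.add_sub_cancel_left]
    rcases le_or_gt k l with hk | hk
    · have hle : (t + u) * k ≤ S := by
        have := Nat.mul_le_mul_left (t + u) hk
        rw [mul_add, mul_one] at ht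
        omega
      rw [Nat.sub_eq_zero_of_le hk, Nat.sub_eq_zero_of_le (by omega : k ≤ l + 1), mul_zero,
        mul_zero, Nat.sub_eq_zero_of_le hle, add_zero]
    · obtain ⟨v, rfl⟩ : ∃ v, k = l + 1 + v := ⟨k - (l + 1), by omega⟩
      rw [(by omega : l + 1 + v - l = v + 1), Nat.add_sub_cancel_left, mul_add, ht]
      have : (t + u) * v + t = t * (v + 1) + u * v := by ring
      omega
  constructor
  · intro h
    -- Both sides vanish at k = 0; the second difference centred at 1 needs this value.
    have h0 : ∀ k, (s.map fun e => k - e).sum = t * (k - l) + (n - t) * (k - (l + 1)) := by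
      intro k
      rcases Nat.eq_zero_or_pos k with rfl | hk
      · simp
      · rw [h k hk, hval]
    have hc : ∀ j, s.count j = (if j = l then t else 0) + if j = l + 1 then n - t else 0 := by
      intro j
      rcases j with _ | k
      · rw [← sum_map_one_sub, h0]
        rcases Nat.eq_zero_or_pos l with rfl | hl
        · simp
        · simp [hl.ne', Nat.sub_eq_zero_of_le hl, hl.ne]
      · have := sum_map_sub_succ s k
        rw [h0, h0, h0] at this
        by_cases hk1 : k + 1 = l
        · subst hk1
          simpa [Nat.sub_eq_zero_of_le (by omega : k ≤ k + 1 + 1)] using this.symm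
        · by_cases hk2 : k = l
          · subst hk2
            simp at this ⊢
            omega
          · rw [if_neg hk1, if_neg (by omega)]
            rcases Nat.lt_or_gt_of_ne hk2 with hlt | hgt
            · rw [Nat.sub_eq_zero_of_le (by omega : k + 2 ≤ l),
                Nat.sub_eq_zero_of_le (by omega : k + 2 ≤ l + 1),
                Nat.sub_eq_zero_of_le (by omega : k + 1 ≤ l),
                Nat.sub_eq_zero_of_le (by omega : k + 1 ≤ l + 1),
                Nat.sub_eq_zero_of_le (by omega : k ≤ l),
                Nat.sub_eq_zero_of_le (by omega : k ≤ l + 1)] at this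
              simp only [mul_zero, add_zero] at this ⊢
              omega
            · obtain ⟨v, rfl⟩ : ∃ v, k = l + 1 + v := ⟨k - (l + 1), by omega⟩
              rw [(by omega : l + 1 + v + 2 - l = v + 3), (by omega : l + 1 + v - l = v + 1),
                (by omega : l + 1 + v + 1 - l = v + 2),
                (by omega : l + 1 + v + 2 - (l + 1) = v + 2),
                (by omega : l + 1 + v + 1 - (l + 1) = v + 1), Nat.add_sub_cancel_left] at this
              linarith
    refine ⟨?_, ?_, fun j h1 h2 => ?_⟩
    · simp [hc]
    · simp [hc]
    · rw [hc, if_neg (by omega), if_neg h2]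
  · rintro ⟨h1, h2, h3⟩ k -
    rw [hval]
    exact sum_map_sub_of_count l.succ_pos h1 h2 h3 k

/-! ### Full rank expressed through the right minimal indices -/

variable {m n : ℕ}

/-- By rank–nullity, rank min(km + S, k(m + n)) means nullity max(nk - S, 0), which is the truncated
difference. -/
theorem fullTrimmedSylvesterRank_iff {d : Fin m → ℕ} {M : Matrix (Fin m) (Fin (m + n)) F[X]}
    (hM : RowDegreesLE d M) : FullTrimmedSylvesterRank d M ↔
      ∀ k, 1 ≤ k → ((rightMinimalIndices M).map fun e => k - e).sum = n * k - ∑ i, d i := by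
  refine forall₂_congr fun k _ => ?_
  have h := rank_trimmedSylvester_add hM k
  rw [mul_add, mul_comm k n] at h
  rw [mul_add, mul_comm k n]
  omega

end PolyMat

end

theorem mainTheorem4 {F : Type*} [Field F] {m n : ℕ} (hn : 0 < n)
    (d : Fin m → ℕ) (hd : 0 < PolyMat.maxDegree d)
    (M : Matrix (Fin m) (Fin (m + n)) (Polynomial F)) (hM : PolyMat.RowDegreesLE d M)
    (k' t : ℕ) (hk' : k' = ⌈(∑ i, (d i : ℚ)) / (n : ℚ)⌉₊)
    (ht : n * k' = (∑ i, d i) + t) (htn : t < n) :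
    PolyMat.FullTrimmedSylvesterRank d M ↔
      -- no left minimal indices and no finite elementary divisors
      (PolyMat.leftMinimalIndices M = 0 ∧ PolyMat.elementaryDivisors M = 0) ∧
      -- the right minimal indices
      ((PolyMat.rightMinimalIndices M).count (k' - 1) = t ∧
        (PolyMat.rightMinimalIndices M).count k' = n - t ∧
        ∀ j : ℕ, j ≠ k' - 1 → j ≠ k' → (PolyMat.rightMinimalIndices M).count j = 0) ∧
      -- the infinite elementary divisors
      PolyMat.infiniteElementaryDivisors (PolyMat.maxDegree d) M =
        (Finset.univ.filter fun i => d i < PolyMat.maxDegree d).val.map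
          (fun i => (Polynomial.X : Polynomial F) ^ (PolyMat.maxDegree d - d i)) := by
  have hS : 0 < ∑ i, d i := by
    obtain ⟨i, hi, hdi⟩ := Finset.lt_sup_iff.mp hd
    exact hdi.trans_le (Finset.single_le_sum (f := d) (fun _ _ => Nat.zero_le _) hi)
  rw [← PolyMat.sum_map_sub_eq_iff hS ht htn, ← PolyMat.fullTrimmedSylvesterRank_iff hM]
  refine ⟨fun h => ?_, fun h => h.2.1⟩
  -- At k = Σ d_i ≥ 1, n ≥ 1 gives nk ≥ Σ d_i, so full rank is full row rank.
  have hrank := h (∑ i, d i) hS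
  have hle : (∑ i, d i) * m + ∑ i, d i ≤ (∑ i, d i) * (m + n) := by
    rw [mul_add]
    exact Nat.add_le_add_left (Nat.le_mul_of_pos_right _ hn) _
  rw [min_eq_left hle] at hrank
  obtain ⟨N, hN⟩ := PolyMat.exists_right_inverse hM hS hrank
  obtain ⟨L, hL⟩ := PolyMat.exists_leadingRows_right_inverse hM hS hrank
  exact ⟨⟨PolyMat.leftMinimalIndices_eq_zero hN, PolyMat.elementaryDivisors_eq_zero hN⟩, h,
    PolyMat.infiniteElementaryDivisors_eq hM hL⟩
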